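/- Consider the $K$-armed bandit game over $T$ rounds with a fixed sequence of loss vectors $\ell_{1:T}=(\ell_{i,t})_{1\le i\le K,\,1\le t\le T}\in[0,1]^{KT}$. A randomised bandit algorithm chooses in each round $t$, from the history $(I_s,\ell_{I_s,s})_{1\le s\le t-1}$ and possibly from internal randomisation, a probability distribution $p_t$ on $\{1,\dots,K\}$, draws an arm $I_t$ from $p_t$, and then observes only the loss $\ell_{I_t,t}$. Write $$L^*_T=\min_{1\le i\le K}\sum_{t=1}^T\ell_{i,t},\qquad R_T(\ell_{1:T})=\sum_{t=1}^T\ell_{I_t,t}-L^*_T,\qquad \mathcal{B}_{\alpha,T}=\Bigl\{\ell_{1:T}\in[0,1]^{KT}:\ \frac{L^*_T}{T}\le\alpha\Bigr\}.$$ Let $K\ge 2$ and $T\ge \max\{K,118\}$ be integers, and let $$\alpha\in\left[\frac{\max\{\tfrac{64}{9}\log(32T),\,K/2\}}{T},\ \frac12\right].$$ Then for every randomised bandit algorithm $$\sup_{\ell_{1:T}\in\mathcal{B}_{\alpha,T}}\mathbb{E}\bigl[R_T(\ell_{1:T})\bigr]\ \ge\ \frac{1}{27}\sqrt{\alpha T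 K},$$ where the expectation is taken with respect to the internal randomisation of the algorithm. -/

import Mathlib

open MeasureTheory

noncomputable section

namespace Bandit

/-- A loss sequence `ℓ` over `T` rounds and `K` arms: `ℓ t i ∈ [0,1]` is the loss of arm `i`
in round `t`. -/
abbrev LossSeq (K T : ℕ) : Type := Fin T → Fin K → unitInterval

/-- What the learner has seen after `t` rounds: for each of them the arm that was played and the
loss of that arm (and of no other arm). -/
abbrev History (K t : ℕ) : Type := Fin t → Fin K × unitInterval

/-- A randomised bandit algorithm with `K` arms. It may use an internal random seed `ω`, drawn once
from an arbitrary probability space. After `t` rounds with history `h` it forms the probability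
vector `weight t ω h` on the arms and draws its next arm from it.
The case of weights that depend on the history only (no seed) is that of a one-point `Ω`, and the
case where all the randomness is in the seed is that of Dirac weights. -/
structure RandomisedAlgorithm (K : ℕ) where
  /-- the space of seeds -/
  Ω : Type*
  [measurableSpace : MeasurableSpace Ω]
  /-- the law of the seed -/
  P : Measure Ω
  [isProbabilityMeasure : IsProbabilityMeasure P]
  /-- the probability vector from which the next arm is drawn after `t` rounds -/
  weight : (t : ℕ) → Ω → History K t → Fin K → ℝ
  weight_nonneg : ∀ t ω h i, 0 ≤ weight t ω h i
  weight_sum : ∀ t ω h, ∑ i, weight t ω h i = 1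
  weight_measurable : ∀ t h i, Measurable fun ω => weight t ω h i

attribute [instance] RandomisedAlgorithm.measurableSpace RandomisedAlgorithm.isProbabilityMeasure

variable {K T : ℕ}

/-- The cumulative loss of the best arm, `L*_T = min_i ∑_t ℓ_{i,t}`. -/
def bestLoss (ℓ : LossSeq K T) : ℝ := ⨅ i : Fin K, ∑ t, (ℓ t i : ℝ)

/-- The regret `R_T` on `ℓ` when the arms played are `a 0, …, a (T - 1)`. -/
def regret (ℓ : LossSeq K T) (a : Fin T → Fin K) : ℝ := ∑ t, (ℓ t (a t) : ℝ) - bestLoss ℓ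

/-- The history available at the beginning of round `t` (rounds are counted from `0`) when the
losses are `ℓ` and the arms played are `a`. -/
def history (ℓ : LossSeq K T) (a : Fin T → Fin K) (t : Fin T) : History K t :=
  fun s => (a (s.castLE t.isLt.le), ℓ (s.castLE t.isLt.le) (a (s.castLE t.isLt.le)))

/-- The probability, given the seed `ω`, that the algorithm plays exactly the arms `a` when the
losses are `ℓ`: the product over the rounds of the conditional probabilities of the arm played. -/
def RandomisedAlgorithm.playProb (A : RandomisedAlgorithm K) (ℓ : LossSeq K T) (ω : A.Ω)
    (a : Fin T → Fin K) : ℝ :=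
  ∏ t : Fin T, A.weight t ω (history ℓ a t) (a t)

/-- The expected regret `𝔼[R_T(ℓ)]` on the fixed loss sequence `ℓ`; the expectation is over the
seed and over the draws of the arms. -/
def RandomisedAlgorithm.expectedRegret (A : RandomisedAlgorithm K) (ℓ : LossSeq K T) : ℝ :=
  ∫ ω, ∑ a : Fin T → Fin K, A.playProb ℓ ω a * regret ℓ a ∂A.P

/-- The small-loss ball: the loss sequences with `L*_T / T ≤ α`. -/
def smallLossBall (K T : ℕ) (α : ℝ) : Set (LossSeq K T) := {ℓ | bestLoss ℓ / T ≤ α}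

end Bandit

end

/-! The losses are drawn at random: independent Bernoulli entries with mean p = α/2, except that one
hidden arm i has the slightly smaller mean q = p - ε. If arm i is played N_i times, the expected
regret is at least ε(T - E_i N_i).

To bound E_i N_i, environment i is compared with the one where all means are p. The algorithm's
weights cancel in the likelihood ratio, so the divergence is the expectation of N_i under the
uniform law times a Bernoulli divergence, at most ε²/(q(1-q)). `log_two_mul_sum_add_le` turns this
into a bound on T - E_i N_i (`log_two_mul_le_add`). Summing over i, with ∑ N_i = T, gives total
regret at least εT(log 2 (K-1) - Tε²/(q(1-q))).

A random table may leave the small-loss ball, but only if arm i loses more than αT, about twice its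
mean or more. By Chernoff this costs at most 1/32 of regret (`tail_le`). Taking ε of order √(αK/T)
concludes (`exists_gap`). -/

namespace Bandit

open Finset MeasureTheory

/-! ### Finite path measures built from transition kernels -/

section Path

variable {X : Type*}

/-- The weight of a path when the next point is drawn from `κ t` given the first `t` points. -/
def pathWeight (κ : (t : ℕ) → (Fin t → X) → X → ℝ) (T : ℕ) (h : Fin T → X) : ℝ :=
  ∏ t : Fin T, κ t (fun s => h (s.castLE t.isLt.le)) (h t)

lemma pathWeight_snoc (κ : (t : ℕ) → (Fin t → X) → X → ℝ) (T : ℕ) (h : Fin T → X) (y : X) :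
    pathWeight κ (T + 1) (Fin.snoc (α := fun _ => X) h y) = pathWeight κ T h * κ T h y := by
  unfold pathWeight
  rw [Fin.prod_univ_castSucc]
  congr 1
  · refine Finset.prod_congr rfl fun t _ => ?_
    rw [Fin.snoc_castSucc]
    congr 1
    funext s
    exact Fin.snoc_castSucc (α := fun _ => X) y h (s.castLE t.isLt.le)
  · rw [Fin.snoc_last]
    congr 1
    funext s
    exact Fin.snoc_castSucc (α := fun _ => X) y h s

lemma pathWeight_nonneg {κ : (t : ℕ) → (Fin t → X) → X → ℝ} (hκ : ∀ t h y, 0 ≤ κ t h y)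
    (T : ℕ) (h : Fin T → X) : 0 ≤ pathWeight κ T h :=
  Finset.prod_nonneg fun _ _ => hκ _ _ _

variable [Fintype X]

lemma sum_snoc (T : ℕ) (F : (Fin (T + 1) → X) → ℝ) :
    ∑ h, F h = ∑ h : Fin T → X, ∑ y, F (Fin.snoc (α := fun _ => X) h y) := by
  rw [← (Fin.snocEquiv (fun _ : Fin (T + 1) => X)).sum_comp, Fintype.sum_prod_type_right]
  rfl

lemma sum_pathWeight {κ : (t : ℕ) → (Fin t → X) → X → ℝ} (hκ : ∀ t h, ∑ y, κ t h y = 1)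
    (T : ℕ) : ∑ h, pathWeight κ T h = 1 := by
  induction T with
  | zero => simp [pathWeight]
  | succ T ih =>
    rw [sum_snoc]
    simp_rw [pathWeight_snoc, ← Finset.mul_sum, hκ, mul_one, ih]

/-- Tower property: additive functionals see each round only through its conditional mean given the
past. -/
lemma sum_pathWeight_mul_sum_congr {κ : (t : ℕ) → (Fin t → X) → X → ℝ}
    (hκ : ∀ t h, ∑ y, κ t h y = 1) {g g' : X → ℝ}
    (hg : ∀ t h, ∑ y, κ t h y * g y = ∑ y, κ t h y * g' y) (T : ℕ) :
    ∑ h, pathWeight κ T h * ∑ t, g (h t) = ∑ h, pathWeight κ T h * ∑ t, g' (h t) := by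
  induction T with
  | zero => simp
  | succ T ih =>
    have key : ∀ f : X → ℝ, ∑ h, pathWeight κ (T + 1) h * ∑ t, f (h t)
        = ∑ h, pathWeight κ T h * ∑ t, f (h t)
          + ∑ h, pathWeight κ T h * ∑ y, κ T h y * f y := by
      intro f
      rw [sum_snoc, ← Finset.sum_add_distrib]
      refine Finset.sum_congr rfl fun h _ => ?_
      simp_rw [pathWeight_snoc, Fin.sum_univ_castSucc, Fin.snoc_castSucc, Fin.snoc_last, mul_add,
        Finset.sum_add_distrib, mul_assoc, ← Finset.mul_sum, ← Finset.sum_mul, hκ, one_mul]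
    rw [key, key, ih]
    simp_rw [hg]

lemma sum_pathWeight_mul_sum_const {κ : (t : ℕ) → (Fin t → X) → X → ℝ}
    (hκ : ∀ t h, ∑ y, κ t h y = 1) {g : X → ℝ} {c : ℝ}
    (hg : ∀ t h, ∑ y, κ t h y * g y = c) (T : ℕ) :
    ∑ h, pathWeight κ T h * ∑ t, g (h t) = T * c := by
  rw [sum_pathWeight_mul_sum_congr hκ (g' := fun _ => c)]
  · simp [← Finset.sum_mul, sum_pathWeight hκ]
  · intro t h
    rw [hg, ← Finset.sum_mul, hκ, one_mul]

end Path

/-! ### Change of measure -/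

/-- A change of measure bound for the mean of a `[0, 1]`-valued function. -/
lemma log_two_mul_sum_add_le {H : Type*} [Fintype H] {P Q f L : H → ℝ} (hP : ∀ h, 0 ≤ P h)
    (hPsum : ∑ h, P h = 1) (hQsum : ∑ h, Q h = 1) (hQ : ∀ h, Q h = P h * Real.exp (L h))
    (hf0 : ∀ h, 0 ≤ f h) (hf1 : ∀ h, f h ≤ 1) :
    Real.log 2 * ∑ h, P h * f h + ∑ h, P h * L h ≤ ∑ h, Q h * f h := by
  -- Convexity: on [0, 1] the chord of 2^f is exactly 1 + f, which is why the tilt is log 2.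
  have two_rpow : ∀ h, Real.exp (Real.log 2 * f h) ≤ 1 + f h := by
    intro h
    have := (convexOn_exp).2 (Set.mem_univ 0) (Set.mem_univ (Real.log 2))
      (sub_nonneg.2 (hf1 h)) (hf0 h) (by ring)
    simp only [smul_eq_mul, mul_zero, zero_add, Real.exp_zero, mul_one,
      Real.exp_log (show (0 : ℝ) < 2 by norm_num)] at this
    rw [mul_comm]
    linarith
  have pt : ∀ h, P h * (Real.log 2 * f h + L h) ≤ Q h * f h + Q h - P h := by
    intro h
    have h1 := Real.add_one_le_exp (Real.log 2 * f h + L h)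
    rw [Real.exp_add] at h1
    have h2 : Real.exp (Real.log 2 * f h) * Real.exp (L h) ≤ (1 + f h) * Real.exp (L h) :=
      mul_le_mul_of_nonneg_right (two_rpow h) (Real.exp_pos _).le
    have h3 := mul_le_mul_of_nonneg_left (h1.trans h2) (hP h)
    rw [hQ]
    linarith
  have := Finset.sum_le_sum fun h (_ : h ∈ Finset.univ) => pt h
  rw [Finset.sum_sub_distrib, Finset.sum_add_distrib, hPsum, hQsum] at this
  simp_rw [mul_add, Finset.sum_add_distrib, mul_left_comm _ (Real.log 2), ← Finset.mul_sum] at this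
  linarith

/-! ### Bernoulli losses and random tables -/

/-- The Bernoulli mass function with mean `m`. -/
def bern (m : ℝ) (x : Bool) : ℝ := if x then m else 1 - m

/-- The loss `0` or `1` coded by a Boolean. -/
def bit (x : Bool) : unitInterval := if x then 1 else 0

lemma bern_sum (m : ℝ) : ∑ x, bern m x = 1 := by simp [bern]

lemma bern_nonneg {m : ℝ} (h0 : 0 ≤ m) (h1 : m ≤ 1) (x : Bool) : 0 ≤ bern m x := by
  cases x <;> simp [bern, h0, h1]

lemma bern_pos {m : ℝ} (h0 : 0 < m) (h1 : m < 1) (x : Bool) : 0 < bern m x := by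
  cases x <;> simp [bern, h0, h1]

lemma bern_sum_bit (m : ℝ) : ∑ x, bern m x * (bit x : ℝ) = m := by simp [bern, bit]

/-- A lower bound for minus the Kullback-Leibler divergence of two Bernoulli laws. -/
lemma neg_le_sum_bern_mul_log {p q : ℝ} (hq0 : 0 < q) (hqp : q ≤ p) (hp1 : p < 1) :
    -((p - q) ^ 2 / (q * (1 - q))) ≤ ∑ x, bern p x * Real.log (bern q x / bern p x) := by
  have hp0 : 0 < p := hq0.trans_le hqp
  have hq1 : 0 < 1 - q := by linarith
  have hp1' : 0 < 1 - p := by linarith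
  -- log y ≥ 1 - 1/y bounds the divergence by the χ² distance.
  have h1 := Real.one_sub_inv_le_log_of_pos (div_pos hq0 hp0)
  have h2 := Real.one_sub_inv_le_log_of_pos (div_pos hq1 hp1')
  have h3 := mul_le_mul_of_nonneg_left h1 hp0.le
  have h4 := mul_le_mul_of_nonneg_left h2 hp1'.le
  have h5 : p * (1 - (q / p)⁻¹) + (1 - p) * (1 - ((1 - q) / (1 - p))⁻¹)
      = -((p - q) ^ 2 / (q * (1 - q))) := by
    field_simp
    ring
  simp only [bern, Fintype.sum_bool, if_true, Bool.false_eq_true, if_false]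
  linarith

variable {K T : ℕ}

/-- The probability of the table `v` of binary losses when the loss of arm `j` has mean `m j`. -/
def tableProb (m : Fin K → ℝ) (v : Fin T → Fin K → Bool) : ℝ := ∏ t, ∏ j, bern (m j) (v t j)

/-- The loss sequence coded by a table of Booleans. -/
def tableLoss (v : Fin T → Fin K → Bool) : LossSeq K T := fun t i => bit (v t i)

lemma tableProb_nonneg {m : Fin K → ℝ} (h0 : ∀ j, 0 ≤ m j) (h1 : ∀ j, m j ≤ 1)
    (v : Fin T → Fin K → Bool) : 0 ≤ tableProb m v :=
  Finset.prod_nonneg fun _ _ => Finset.prod_nonneg fun j _ => bern_nonneg (h0 j) (h1 j) _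

lemma sum_prod_bern_mul_ite (m : Fin K → ℝ) (i : Fin K) (x : Bool) :
    ∑ u : Fin K → Bool, (∏ j, bern (m j) (u j)) * (if u i = x then 1 else 0) = bern (m i) x := by
  have h : ∀ u : Fin K → Bool, (∏ j, bern (m j) (u j)) * (if u i = x then 1 else 0)
      = ∏ j, bern (m j) (u j) * (if j = i then (if u j = x then 1 else 0) else 1) := by
    intro u
    rw [Finset.prod_mul_distrib, Finset.prod_ite_eq' Finset.univ i]
    simp
  simp_rw [h]
  rw [← Fintype.piFinset_univ, ← Finset.prod_univ_sum (fun _ => Finset.univ)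
    (fun j y => bern (m j) y * (if j = i then (if y = x then 1 else 0) else 1)),
    Finset.prod_eq_single i]
  · simp
  · intro j _ hj
    simp only [if_neg hj, mul_one, bern_sum]
  · simp

/-- The observed losses along a fixed sequence of arms are independent Bernoulli variables. -/
lemma sum_tableProb_mul (m : Fin K → ℝ) (a : Fin T → Fin K) (F : (Fin T → Bool) → ℝ) :
    ∑ v, tableProb m v * F (fun t => v t (a t))
      = ∑ x : Fin T → Bool, (∏ t, bern (m (a t)) (x t)) * F x := by
  -- Expanding `F` in indicators of points lets the sum over tables factor entrywise.
  have hF : ∀ y : Fin T → Bool,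
      F y = ∑ x : Fin T → Bool, (∏ t, if y t = x t then (1 : ℝ) else 0) * F x := by
    intro y
    rw [Finset.sum_eq_single y]
    · simp
    · intro x _ hx
      obtain ⟨t, ht⟩ := Function.ne_iff.1 hx
      rw [Finset.prod_eq_zero (Finset.mem_univ t) (if_neg ht.symm), zero_mul]
    · simp
  have hF' : ∀ v : Fin T → Fin K → Bool, tableProb m v * F (fun t => v t (a t))
      = ∑ x : Fin T → Bool, tableProb m v * ((∏ t, if v t (a t) = x t then (1 : ℝ) else 0) * F x) :=
    fun v => by rw [hF (fun t => v t (a t)), Finset.mul_sum]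
  rw [Finset.sum_congr rfl fun v _ => hF' v, Finset.sum_comm]
  refine Finset.sum_congr rfl fun x _ => ?_
  simp_rw [← mul_assoc, ← Finset.sum_mul]
  congr 1
  simp_rw [tableProb, ← Finset.prod_mul_distrib]
  rw [← Fintype.piFinset_univ, ← Finset.prod_univ_sum (fun _ => Finset.univ)
    (fun t (u : Fin K → Bool) => (∏ j, bern (m j) (u j)) * (if u (a t) = x t then 1 else 0))]
  exact Finset.prod_congr rfl fun t _ => sum_prod_bern_mul_ite m (a t) (x t)

lemma sum_prod_bern (m : ℝ) (g : Bool → ℝ) :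
    ∑ x : Fin T → Bool, (∏ t, bern m (x t)) * ∏ t, g (x t) = (∑ y, bern m y * g y) ^ T := by
  simp_rw [← Finset.prod_mul_distrib]
  rw [← Fintype.piFinset_univ, ← Finset.prod_univ_sum (fun _ => Finset.univ)
    (fun _ y => bern m y * g y)]
  simp

lemma sum_tableProb (m : Fin K → ℝ) (i : Fin K) :
    ∑ v : Fin T → Fin K → Bool, tableProb m v = 1 := by
  have := sum_tableProb_mul (T := T) m (fun _ => i) (fun _ => ∏ _t : Fin T, (1 : ℝ))
  rw [sum_prod_bern (m i) (fun _ => 1)] at this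
  simpa only [mul_one, bern_sum, Finset.prod_const_one, one_pow] using this

lemma sum_tableProb_mul_armLoss (m : Fin K → ℝ) (i : Fin K) :
    ∑ v : Fin T → Fin K → Bool, tableProb m v * ∑ t, (tableLoss v t i : ℝ) = T * m i := by
  have h := sum_tableProb_mul (T := T) m (fun _ => i) (fun x => ∑ t, (bit (x t) : ℝ))
  refine h.trans ?_
  exact sum_pathWeight_mul_sum_const (κ := fun _ _ => bern (m i)) (fun _ _ => bern_sum _)
    (fun _ _ => bern_sum_bit _) T

/-- A Chernoff bound for the cumulative loss of one arm. -/
lemma sum_tableProb_mul_ite_le {m : Fin K → ℝ} (h0 : ∀ j, 0 ≤ m j) (h1 : ∀ j, m j ≤ 1)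
    (i : Fin K) (b : ℝ) :
    ∑ v : Fin T → Fin K → Bool,
        tableProb m v * (if b < ∑ t, (tableLoss v t i : ℝ) then 1 else 0)
      ≤ Real.exp (T * m i - b * Real.log 2) := by
  -- Markov's inequality for 2 to the power of the loss; each round then contributes a factor 1 + m
  -- i.
  have hpt : ∀ v : Fin T → Fin K → Bool,
      (if b < ∑ t, (tableLoss v t i : ℝ) then (1 : ℝ) else 0)
        ≤ Real.exp (-(b * Real.log 2)) * ∏ t, Real.exp ((bit (v t i) : ℝ) * Real.log 2) := by
    intro v
    rw [← Real.exp_sum, ← Real.exp_add, ← Finset.sum_mul]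
    split_ifs with h
    · apply Real.one_le_exp
      have : 0 < Real.log 2 := Real.log_pos (by norm_num)
      have h' := mul_le_mul_of_nonneg_right h.le this.le
      simp only [tableLoss] at h'
      linarith
    · exact (Real.exp_pos _).le
  calc _ ≤ ∑ v : Fin T → Fin K → Bool, tableProb m v * (Real.exp (-(b * Real.log 2)) *
          ∏ t, Real.exp ((bit (v t i) : ℝ) * Real.log 2)) :=
        Finset.sum_le_sum fun v _ =>
          mul_le_mul_of_nonneg_left (hpt v) (tableProb_nonneg h0 h1 v)
    _ = Real.exp (-(b * Real.log 2)) * (1 + m i) ^ T := by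
        simp_rw [mul_left_comm _ (Real.exp _), ← Finset.mul_sum]
        congr 1
        have := sum_tableProb_mul (T := T) m (fun _ => i)
          (fun x => ∏ t, Real.exp ((bit (x t) : ℝ) * Real.log 2))
        refine this.trans ?_
        rw [sum_prod_bern (m i) (fun y => Real.exp ((bit y : ℝ) * Real.log 2))]
        congr 1
        simp only [bern, bit, Fintype.sum_bool, if_true, Bool.false_eq_true, if_false,
          Set.Icc.coe_one, Set.Icc.coe_zero, one_mul, zero_mul, Real.exp_zero,
          Real.exp_log (show (0 : ℝ) < 2 by norm_num)]
        ring
    _ ≤ Real.exp (-(b * Real.log 2)) * Real.exp (m i) ^ T := by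
        have := Real.add_one_le_exp (m i)
        have := h0 i
        gcongr
        linarith
    _ = Real.exp (T * m i - b * Real.log 2) := by
        rw [← Real.exp_nat_mul, ← Real.exp_add]
        ring_nf

/-! ### Play probabilities and observed histories -/

namespace RandomisedAlgorithm

variable (A : RandomisedAlgorithm K)

lemma playProb_nonneg (ℓ : LossSeq K T) (ω : A.Ω) (a : Fin T → Fin K) : 0 ≤ A.playProb ℓ ω a :=
  Finset.prod_nonneg fun _ _ => A.weight_nonneg _ _ _ _

lemma sum_playProb (ℓ : LossSeq K T) (ω : A.Ω) : ∑ a, A.playProb ℓ ω a = 1 := by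
  -- Kernels are needed at all times, so losses after round T are padded by 0; they are never
  -- reached.
  have h := sum_pathWeight (X := Fin K) (κ := fun t a k => A.weight t ω
    (fun s => (a s, if h : (s : ℕ) < T then ℓ ⟨s, h⟩ (a s) else 0)) k)
    (fun t a => A.weight_sum _ _ _) T
  rw [← h]
  refine Finset.sum_congr rfl fun a _ => Finset.prod_congr rfl fun t _ => ?_
  congr 1
  funext s
  have hs : (s : ℕ) < T := s.isLt.trans t.isLt
  simp only [history, hs, dif_pos]
  rfl

lemma measurable_playProb (ℓ : LossSeq K T) (a : Fin T → Fin K) :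
    Measurable fun ω => A.playProb ℓ ω a :=
  Finset.measurable_prod _ fun _ _ => A.weight_measurable _ _ _

lemma playProb_le_one (ℓ : LossSeq K T) (ω : A.Ω) (a : Fin T → Fin K) : A.playProb ℓ ω a ≤ 1 := by
  rw [← A.sum_playProb ℓ ω]
  exact Finset.single_le_sum (f := fun a => A.playProb ℓ ω a)
    (fun a _ => A.playProb_nonneg ℓ ω a) (Finset.mem_univ a)

lemma integrable_playProb (ℓ : LossSeq K T) (a : Fin T → Fin K) :
    Integrable (fun ω => A.playProb ℓ ω a) A.P := by
  refine Integrable.of_bound (A.measurable_playProb ℓ a).aestronglyMeasurable 1 ?_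
  filter_upwards with ω
  rw [Real.norm_of_nonneg (A.playProb_nonneg ℓ ω a)]
  exact A.playProb_le_one ℓ ω a

/-- The conditional expected regret given the seed. -/
noncomputable def seedRegret (ℓ : LossSeq K T) (ω : A.Ω) : ℝ := ∑ a, A.playProb ℓ ω a * regret ℓ a

lemma integrable_seedRegret (ℓ : LossSeq K T) : Integrable (A.seedRegret ℓ) A.P :=
  integrable_finsetSum _ fun a _ => (A.integrable_playProb ℓ a).mul_const _

lemma expectedRegret_eq (ℓ : LossSeq K T) : A.expectedRegret ℓ = ∫ ω, A.seedRegret ℓ ω ∂A.P := rfl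

end RandomisedAlgorithm

lemma bestLoss_le (ℓ : LossSeq K T) (i : Fin K) : bestLoss ℓ ≤ ∑ t, (ℓ t i : ℝ) :=
  ciInf_le (Set.finite_range _).bddBelow i

lemma bestLoss_nonneg (ℓ : LossSeq K T) : 0 ≤ bestLoss ℓ :=
  Real.iInf_nonneg fun _ => Finset.sum_nonneg fun _ _ => unitInterval.nonneg _

lemma regret_le (ℓ : LossSeq K T) (a : Fin T → Fin K) : regret ℓ a ≤ T := by
  have h : ∑ t, (ℓ t (a t) : ℝ) ≤ ∑ _t : Fin T, (1 : ℝ) :=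
    Finset.sum_le_sum fun _ _ => unitInterval.le_one _
  have := bestLoss_nonneg ℓ
  simp at h
  unfold regret
  linarith

lemma RandomisedAlgorithm.expectedRegret_le (A : RandomisedAlgorithm K) (ℓ : LossSeq K T) :
    A.expectedRegret ℓ ≤ T := by
  have h : ∀ ω, A.seedRegret ℓ ω ≤ T := by
    intro ω
    calc A.seedRegret ℓ ω ≤ ∑ a, A.playProb ℓ ω a * (T : ℝ) :=
          Finset.sum_le_sum fun a _ =>
            mul_le_mul_of_nonneg_left (regret_le ℓ a) (A.playProb_nonneg ℓ ω a)
      _ = T := by rw [← Finset.sum_mul, A.sum_playProb, one_mul]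
  calc A.expectedRegret ℓ ≤ ∫ _ω, (T : ℝ) ∂A.P :=
        integral_mono (A.integrable_seedRegret ℓ) (integrable_const _) h
    _ = T := by simp

/-- The transition weights of the pairs of arm played and loss observed, when the loss of arm `j`
is a Bernoulli variable with mean `m j`. -/
def RandomisedAlgorithm.obsKernel (A : RandomisedAlgorithm K) (ω : A.Ω) (m : Fin K → ℝ) (t : ℕ)
    (h : Fin t → Fin K × Bool) (y : Fin K × Bool) : ℝ :=
  A.weight t ω (fun s => ((h s).1, bit (h s).2)) y.1 * bern (m y.1) y.2

namespace RandomisedAlgorithm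

variable (A : RandomisedAlgorithm K) (ω : A.Ω)

lemma obsKernel_nonneg {m : Fin K → ℝ} (h0 : ∀ j, 0 ≤ m j) (h1 : ∀ j, m j ≤ 1) (t : ℕ)
    (h : Fin t → Fin K × Bool) (y : Fin K × Bool) : 0 ≤ A.obsKernel ω m t h y :=
  mul_nonneg (A.weight_nonneg _ _ _ _) (bern_nonneg (h0 _) (h1 _) _)

lemma sum_obsKernel_mul (m : Fin K → ℝ) (t : ℕ) (h : Fin t → Fin K × Bool)
    (g : Fin K × Bool → ℝ) :
    ∑ y, A.obsKernel ω m t h y * g y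
      = ∑ a, A.weight t ω (fun s => ((h s).1, bit (h s).2)) a * ∑ x, bern (m a) x * g (a, x) := by
  rw [Fintype.sum_prod_type]
  simp_rw [obsKernel, mul_assoc, ← Finset.mul_sum]

lemma sum_obsKernel (m : Fin K → ℝ) (t : ℕ) (h : Fin t → Fin K × Bool) :
    ∑ y, A.obsKernel ω m t h y = 1 := by
  have := A.sum_obsKernel_mul ω m t h (fun _ => 1)
  simp_rw [mul_one, bern_sum, mul_one, A.weight_sum] at this
  exact this

lemma sum_obsKernel_mul_bern (m : Fin K → ℝ) (t : ℕ) (h : Fin t → Fin K × Bool)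
    (g : Fin K × Bool → ℝ) :
    ∑ y, A.obsKernel ω m t h y * g y
      = ∑ y, A.obsKernel ω m t h y * ∑ x, bern (m y.1) x * g (y.1, x) := by
  rw [sum_obsKernel_mul, sum_obsKernel_mul]
  simp_rw [← Finset.sum_mul, bern_sum, one_mul]

/-- Averages over random tables of losses and arms, as averages over paths of observations. -/
lemma sum_tableProb_mul_sum_playProb (m : Fin K → ℝ)
    (G : (Fin T → Fin K × Bool) → ℝ) :
    ∑ v : Fin T → Fin K → Bool, tableProb m v *
        ∑ a, A.playProb (tableLoss v) ω a * G (fun t => (a t, v t (a t)))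
      = ∑ h, pathWeight (A.obsKernel ω m) T h * G h := by
  simp_rw [Finset.mul_sum]
  rw [Finset.sum_comm, ← (Equiv.arrowProdEquivProdArrow (Fin T) (fun _ => Fin K)
    (fun _ => Bool)).symm.sum_comp, Fintype.sum_prod_type]
  refine Finset.sum_congr rfl fun a _ => ?_
  -- With the arms fixed, everything depends on the table only through the entries played.
  refine (sum_tableProb_mul m a (fun x => (∏ t : Fin T, A.weight t ω
    (fun s => (a (s.castLE t.isLt.le), bit (x (s.castLE t.isLt.le)))) (a t)) *
      G (fun t => (a t, x t)))).trans ?_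
  refine Finset.sum_congr rfl fun x _ => ?_
  rw [← mul_assoc, ← Finset.prod_mul_distrib]
  congr 1
  refine Finset.prod_congr rfl fun t _ => ?_
  rw [mul_comm]
  rfl

end RandomisedAlgorithm

/-- The means of the losses: `p`, but `q` for the arm `i`. -/
def means (p q : ℝ) (i j : Fin K) : ℝ := if j = i then q else p

/-! ### Regret lower bound for a fixed seed -/

section FixedSeed

variable (A : RandomisedAlgorithm K) (ω : A.Ω)

/-- The number of plays of arm `i`. -/
def plays (i : Fin K) (h : Fin T → Fin K × Bool) : ℝ := ∑ t, if (h t).1 = i then 1 else 0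

lemma plays_nonneg (i : Fin K) (h : Fin T → Fin K × Bool) : 0 ≤ plays i h :=
  Finset.sum_nonneg fun t _ => by split_ifs <;> norm_num

lemma plays_le (i : Fin K) (h : Fin T → Fin K × Bool) : plays i h ≤ T := by
  calc plays i h ≤ ∑ _t : Fin T, (1 : ℝ) :=
        Finset.sum_le_sum fun t _ => by split_ifs <;> norm_num
    _ = T := by simp

lemma sum_plays (h : Fin T → Fin K × Bool) : ∑ i, plays i h = T := by
  unfold plays
  rw [Finset.sum_comm]
  simp

/-- The best arm loses no more than arm i, and each play of another arm costs p - q more on average.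
-/
lemma le_sum_tableProb_mul_seedRegret {p q : ℝ} (hq0 : 0 ≤ q) (hqp : q ≤ p) (hp1 : p ≤ 1)
    (i : Fin K) :
    (p - q) * (T - ∑ h : Fin T → Fin K × Bool,
        pathWeight (A.obsKernel ω (means p q i)) T h * plays i h)
      ≤ ∑ v : Fin T → Fin K → Bool, tableProb (means p q i) v * A.seedRegret (tableLoss v) ω := by
  have hm0 : ∀ j, 0 ≤ means p q i j := fun j => by unfold means; split_ifs <;> linarith
  have hm1 : ∀ j, means p q i j ≤ 1 := fun j => by unfold means; split_ifs <;> linarith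
  have h1 : ∀ v : Fin T → Fin K → Bool,
      ∑ a, A.playProb (tableLoss v) ω a * ∑ t, (bit (v t (a t)) : ℝ) - ∑ t, (tableLoss v t i : ℝ)
        ≤ A.seedRegret (tableLoss v) ω := by
    intro v
    calc _ = ∑ a, A.playProb (tableLoss v) ω a *
          (∑ t, (bit (v t (a t)) : ℝ) - ∑ t, (tableLoss v t i : ℝ)) := by
          simp_rw [mul_sub, Finset.sum_sub_distrib, ← Finset.sum_mul, A.sum_playProb, one_mul]
      _ ≤ _ := Finset.sum_le_sum fun a _ => mul_le_mul_of_nonneg_left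
          (sub_le_sub_left (bestLoss_le _ i) _) (A.playProb_nonneg _ _ _)
  refine le_trans (le_of_eq ?_) (Finset.sum_le_sum fun v _ =>
    mul_le_mul_of_nonneg_left (h1 v) (tableProb_nonneg hm0 hm1 v))
  simp_rw [mul_sub, Finset.sum_sub_distrib]
  rw [sum_tableProb_mul_armLoss,
    A.sum_tableProb_mul_sum_playProb ω _ (fun h => ∑ t, (bit (h t).2 : ℝ)),
    sum_pathWeight_mul_sum_congr (A.sum_obsKernel ω _) (g := fun y => (bit y.2 : ℝ))
      (g' := fun y => p - (p - q) * if y.1 = i then 1 else 0)]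
  · simp_rw [Finset.sum_sub_distrib, mul_sub, Finset.sum_sub_distrib, ← Finset.sum_mul,
      sum_pathWeight (A.sum_obsKernel ω _), ← Finset.mul_sum, mul_left_comm _ (p - q),
      ← Finset.mul_sum, plays]
    simp [means]
    ring
  · intro t h
    rw [A.sum_obsKernel_mul_bern]
    refine Finset.sum_congr rfl fun y _ => ?_
    rw [bern_sum_bit, means]
    congr 1
    split_ifs <;> ring

/-- Change of measure for the fraction of rounds not spent on arm i, multiplied by T. The
log-likelihood ratio vanishes off arm i, so only plays of i contribute. -/
lemma log_two_mul_le_add {p q : ℝ} (hq0 : 0 < q) (hqp : q ≤ p) (hp1 : p < 1) (hT : 0 < T)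
    (i : Fin K) :
    Real.log 2 * (T - ∑ h : Fin T → Fin K × Bool,
          pathWeight (A.obsKernel ω (fun _ => p)) T h * plays i h)
        - T * ((p - q) ^ 2 / (q * (1 - q))) * ∑ h : Fin T → Fin K × Bool,
          pathWeight (A.obsKernel ω (fun _ => p)) T h * plays i h
      ≤ T - ∑ h : Fin T → Fin K × Bool,
          pathWeight (A.obsKernel ω (means p q i)) T h * plays i h := by
  have hp0 : 0 < p := hq0.trans_le hqp
  have hT' : (0 : ℝ) < T := by exact_mod_cast hT
  set g : Fin K × Bool → ℝ := fun y => Real.log (bern (means p q i y.1) y.2 / bern p y.2) with hg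
  have key := log_two_mul_sum_add_le (H := Fin T → Fin K × Bool)
    (P := pathWeight (A.obsKernel ω (fun _ => p)) T)
    (Q := pathWeight (A.obsKernel ω (means p q i)) T)
    (f := fun h => 1 - plays i h / T) (L := fun h => ∑ t, g (h t))
    (pathWeight_nonneg (A.obsKernel_nonneg ω (fun _ => hp0.le) (fun _ => hp1.le)) T)
    (sum_pathWeight (A.sum_obsKernel ω _) T) (sum_pathWeight (A.sum_obsKernel ω _) T)
    (fun h => by
      unfold pathWeight
      rw [Real.exp_sum, ← Finset.prod_mul_distrib]
      refine Finset.prod_congr rfl fun t _ => ?_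
      have hb := bern_pos hp0 hp1 (h t).2
      have hb' : 0 < bern (means p q i (h t).1) (h t).2 := by
        unfold means
        split_ifs
        · exact bern_pos hq0 (by linarith) _
        · exact hb
      rw [hg]
      simp only
      rw [Real.exp_log (div_pos hb' hb)]
      unfold RandomisedAlgorithm.obsKernel
      field_simp)
    (fun h => by
      have := (div_le_one hT').2 (plays_le i h)
      linarith)
    (fun h => by
      have := div_nonneg (plays_nonneg i h) hT'.le
      linarith)
  rw [sum_pathWeight_mul_sum_congr (A.sum_obsKernel ω _) (g := g)
      (g' := fun y => (∑ x, bern p x * Real.log (bern q x / bern p x)) *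
        if y.1 = i then 1 else 0)] at key
  · have hkl := neg_le_sum_bern_mul_log hq0 hqp hp1
    simp_rw [← Finset.mul_sum, ← plays.eq_1, mul_sub, Finset.sum_sub_distrib, mul_one,
      sum_pathWeight (A.sum_obsKernel ω _), mul_left_comm _ (∑ x, bern p x * _),
      ← mul_div_assoc, ← Finset.sum_div, ← Finset.mul_sum] at key
    have hn : 0 ≤ ∑ h : Fin T → Fin K × Bool,
        pathWeight (A.obsKernel ω (fun _ => p)) T h * plays i h :=
      Finset.sum_nonneg fun h _ => mul_nonneg (pathWeight_nonneg
        (A.obsKernel_nonneg ω (fun _ => hp0.le) (fun _ => hp1.le)) T h) (plays_nonneg i h)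
    generalize (∑ h : Fin T → Fin K × Bool,
        pathWeight (A.obsKernel ω (fun _ => p)) T h * plays i h) = n at *
    generalize (∑ h : Fin T → Fin K × Bool,
        pathWeight (A.obsKernel ω (means p q i)) T h * plays i h) = n' at *
    generalize (∑ x, bern p x * Real.log (bern q x / bern p x)) = k at *
    generalize ((p - q) ^ 2 / (q * (1 - q))) = d at *
    have h1 := mul_le_mul_of_nonneg_left key hT'.le
    have h2 : (T : ℝ) * (Real.log 2 * (1 - n / T) + k * n)
        = Real.log 2 * (T - n) + T * k * n := by field_simp
    have h3 : (T : ℝ) * (1 - n' / T) = T - n' := by field_simp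
    have h4 := mul_le_mul_of_nonneg_right hkl (mul_nonneg hT'.le hn)
    linarith
  · intro t h
    rw [A.sum_obsKernel_mul_bern]
    refine Finset.sum_congr rfl fun y _ => ?_
    congr 1
    simp only [hg, means]
    split_ifs with hy
    · simp
    · rw [mul_zero]
      refine Finset.sum_eq_zero fun x _ => ?_
      rw [div_self (bern_pos hp0 hp1 x).ne', Real.log_one, mul_zero]

lemma le_sum_sum_tableProb_mul_seedRegret {p q : ℝ} (hq0 : 0 < q) (hqp : q ≤ p) (hp1 : p < 1)
    (hT : 0 < T) :
    (p - q) * T * (Real.log 2 * (K - 1) - T * ((p - q) ^ 2 / (q * (1 - q))))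
      ≤ ∑ i : Fin K, ∑ v : Fin T → Fin K → Bool,
          tableProb (means p q i) v * A.seedRegret (tableLoss v) ω := by
  have h := Finset.sum_le_sum fun i (_ : i ∈ Finset.univ) =>
    (mul_le_mul_of_nonneg_left (log_two_mul_le_add A ω hq0 hqp hp1 hT i)
      (sub_nonneg.2 hqp)).trans (le_sum_tableProb_mul_seedRegret (T := T) A ω hq0.le hqp hp1.le i)
  refine le_trans (le_of_eq ?_) h
  -- The reference law does not depend on i, so its play counts add up to T.
  have hn : ∑ i : Fin K, ∑ h : Fin T → Fin K × Bool,
      pathWeight (A.obsKernel ω (fun _ => p)) T h * plays i h = T := by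
    rw [Finset.sum_comm]
    simp_rw [← Finset.mul_sum, sum_plays, ← Finset.sum_mul, sum_pathWeight (A.sum_obsKernel ω _),
      one_mul]
  simp_rw [← Finset.mul_sum, Finset.sum_sub_distrib, ← Finset.mul_sum, Finset.sum_sub_distrib, hn]
  simp
  ring

end FixedSeed

/-! ### Averaging over the seed and truncating to the ball -/

lemma le_sum_sum_tableProb_mul_expectedRegret (A : RandomisedAlgorithm K) {p q : ℝ} (hq0 : 0 < q)
    (hqp : q ≤ p) (hp1 : p < 1) (hT : 0 < T) :
    (p - q) * T * (Real.log 2 * (K - 1) - T * ((p - q) ^ 2 / (q * (1 - q))))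
      ≤ ∑ i : Fin K, ∑ v : Fin T → Fin K → Bool,
          tableProb (means p q i) v * A.expectedRegret (tableLoss v) := by
  have hint : ∀ (i : Fin K) (v : Fin T → Fin K → Bool),
      Integrable (fun ω => tableProb (means p q i) v * A.seedRegret (tableLoss v) ω) A.P :=
    fun i v => (A.integrable_seedRegret _).const_mul _
  simp_rw [A.expectedRegret_eq, ← integral_const_mul]
  simp_rw [← integral_finsetSum _ fun v _ => hint _ v]
  rw [← integral_finsetSum _ fun i _ => integrable_finsetSum _ fun v _ => hint i v]
  calc _ = ∫ _ω, (p - q) * T * (Real.log 2 * (K - 1) - T * ((p - q) ^ 2 / (q * (1 - q)))) ∂A.P := by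
        simp
    _ ≤ _ := integral_mono (integrable_const _)
        (integrable_finsetSum _ fun i _ => integrable_finsetSum _ fun v _ => hint i v)
        fun ω => le_sum_sum_tableProb_mul_seedRegret A ω hq0 hqp hp1 hT

/-- A bound on the small-loss ball bounds the regret on random tables up to a tail probability. -/
lemma sum_tableProb_mul_expectedRegret_le (A : RandomisedAlgorithm K) {α B p q : ℝ} (hT : 0 < T)
    (hq0 : 0 ≤ q) (hqp : q ≤ p) (hp1 : p ≤ 1) (hB0 : 0 ≤ B)
    (hB : ∀ ℓ ∈ smallLossBall K T α, A.expectedRegret ℓ ≤ B) (i : Fin K) :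
    ∑ v : Fin T → Fin K → Bool, tableProb (means p q i) v * A.expectedRegret (tableLoss v)
      ≤ B + T * Real.exp (T * q - α * T * Real.log 2) := by
  have hT' : (0 : ℝ) < T := by exact_mod_cast hT
  have hm0 : ∀ j, 0 ≤ means p q i j := fun j => by unfold means; split_ifs <;> linarith
  have hm1 : ∀ j, means p q i j ≤ 1 := fun j => by unfold means; split_ifs <;> linarith
  -- Outside the ball the trivial bound T is used; the ball can be left only if arm i itself loses
  -- more than αT.
  have hpt : ∀ v : Fin T → Fin K → Bool, A.expectedRegret (tableLoss v)
      ≤ B + T * (if α * T < ∑ t, (tableLoss v t i : ℝ) then 1 else 0) := by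
    intro v
    split_ifs with h
    · have := A.expectedRegret_le (tableLoss v)
      linarith
    · have : tableLoss v ∈ smallLossBall K T α :=
        (div_le_iff₀ hT').2 ((bestLoss_le _ i).trans (not_lt.1 h))
      have := hB _ this
      linarith
  have htail := sum_tableProb_mul_ite_le (T := T) hm0 hm1 i (α * T)
  have hmi : means p q i i = q := if_pos rfl
  rw [hmi] at htail
  calc _ ≤ ∑ v : Fin T → Fin K → Bool, tableProb (means p q i) v *
        (B + T * (if α * T < ∑ t, (tableLoss v t i : ℝ) then 1 else 0)) :=
        Finset.sum_le_sum fun v _ =>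
          mul_le_mul_of_nonneg_left (hpt v) (tableProb_nonneg hm0 hm1 v)
    _ = B + T * ∑ v : Fin T → Fin K → Bool, tableProb (means p q i) v *
        (if α * T < ∑ t, (tableLoss v t i : ℝ) then 1 else 0) := by
        simp_rw [mul_add, Finset.sum_add_distrib, ← Finset.sum_mul, sum_tableProb _ i, one_mul,
          mul_left_comm _ (T : ℝ), ← Finset.mul_sum]
    _ ≤ _ := by gcongr

/-! ### Numerical estimates -/

lemma eight_le_log {x : ℝ} (hx : 118 ≤ x) : 8 ≤ Real.log (32 * x) := by
  rw [Real.le_log_iff_exp_le (by linarith)]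
  have h : Real.exp 8 = Real.exp 1 ^ 8 := by
    rw [← Real.exp_nat_mul]
    norm_num
  have h1 : Real.exp 1 ^ 8 ≤ (2.7182818286 : ℝ) ^ 8 :=
    pow_le_pow_left₀ (Real.exp_pos 1).le Real.exp_one_lt_d9.le 8
  rw [h]
  refine h1.trans ?_
  norm_num
  linarith

lemma tail_le {x q α : ℝ} (hx : 118 ≤ x) (hq : q ≤ α / 2)
    (hα : 64 / 9 * Real.log (32 * x) ≤ α * x) :
    x * Real.exp (x * q - α * x * Real.log 2) ≤ 1 / 32 := by
  have hx0 : 0 < x := by linarith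
  have hl := eight_le_log hx
  have h2 := Real.log_two_gt_d9
  have h1 : x * q - α * x * Real.log 2 ≤ -Real.log (32 * x) := by
    have := mul_le_mul_of_nonneg_left hq hx0.le
    have h3 := mul_le_mul_of_nonneg_left hα (show (0 : ℝ) ≤ Real.log 2 - 1 / 2 by linarith)
    -- The exponent is at most -(log 2 - 1/2)αx, and 9/64 cancels the factor 64/9 in the hypothesis.
    have h4 : (9 / 64 : ℝ) ≤ Real.log 2 - 1 / 2 := by linarith
    have h5 := mul_le_mul_of_nonneg_right h4 (show 0 ≤ 64 / 9 * Real.log (32 * x) by linarith)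
    linarith
  calc _ ≤ x * Real.exp (-Real.log (32 * x)) := by gcongr
    _ = 1 / 32 := by
      rw [Real.exp_neg, Real.exp_log (by linarith)]
      field_simp

/-- The choice of the gap between the means, and the resulting numerical bound. -/
lemma exists_gap {k x α : ℝ} (hk : k = 2 ∨ 3 ≤ k) (hx : 0 < x) (hα0 : 56 ≤ α * x)
    (hαk : k / 2 ≤ α * x) (hα1 : α ≤ 1 / 2) :
    ∃ q, 0 < q ∧ q ≤ α / 2 ∧
      k * (Real.sqrt (α * x * k) / 27 + 1 / 32) < (α / 2 - q) * x *
        (Real.log 2 * (k - 1) - x * ((α / 2 - q) ^ 2 / (q * (1 - q)))) := by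
  have hα : 0 < α := pos_of_mul_pos_left (by linarith) hx.le
  have hk2 : 2 ≤ k := by rcases hk with h | h <;> linarith
  have hlog := Real.log_two_gt_d9
  obtain ⟨p, hp⟩ : ∃ p, p = α / 2 := ⟨_, rfl⟩
  obtain ⟨S, hS⟩ : ∃ S, S = Real.sqrt (α * x * k) := ⟨_, rfl⟩
  have hSsq : S ^ 2 = α * x * k := by rw [hS, Real.sq_sqrt]; positivity
  have hS10 : 10 ≤ S := by
    rw [hS]
    apply Real.le_sqrt_of_sq_le
    nlinarith
  -- This makes xε² = pk/16, so the divergence term is a small multiple of k.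
  obtain ⟨ε, hε⟩ : ∃ ε, ε = Real.sqrt (p * k / (16 * x)) := ⟨_, rfl⟩
  have hp0 : 0 < p := by rw [hp]; linarith
  have hεsq : ε ^ 2 = p * k / (16 * x) := by rw [hε, Real.sq_sqrt]; positivity
  have hε0 : 0 ≤ ε := by rw [hε]; positivity
  have hεx : x * ε ^ 2 = p * k / 16 := by rw [hεsq]; field_simp
  -- Here k/2 ≤ αx enters: it keeps q ≥ p/2.
  have hεp : ε ≤ p / 2 := by
    apply abs_le_of_sq_le_sq' _ (by linarith) |>.2
    rw [hεsq, div_le_iff₀ (by positivity)]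
    have : k ≤ 4 * (p * x) := by rw [hp]; linarith
    nlinarith
  -- In fact εx = S/√32, and 1/√32 > 0.176.
  have hεS : 0.176 * S ≤ ε * x := by
    apply abs_le_of_sq_le_sq' _ (by positivity) |>.2
    have : (ε * x) ^ 2 = α * x * k / 32 := by
      rw [mul_pow, sq x, ← mul_assoc, mul_comm (ε ^ 2), hεx, hp]; ring
    rw [this, mul_pow, hSsq]
    have : 0 < α * x * k := by positivity
    norm_num
    linarith
  have hq0 : 0 < p - ε := by linarith
  have hq1 : 3 / 4 ≤ 1 - (p - ε) := by linarith
  -- ρ bounds p/q, and 12 = 16 · 3/4.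
  have hd : ∀ ρ, p ≤ ρ * (p - ε) → 0 ≤ ρ →
      x * (ε ^ 2 / ((p - ε) * (1 - (p - ε)))) ≤ k * ρ / 12 := by
    intro ρ hρ hρ0
    rw [← mul_div_assoc, hεx, div_le_iff₀ (mul_pos hq0 (by linarith))]
    have h1 : k * ρ / 12 * ((p - ε) * (3 / 4)) ≤ k * ρ / 12 * ((p - ε) * (1 - (p - ε))) := by
      gcongr
    have h2 := mul_le_mul_of_nonneg_left hρ (show 0 ≤ k by linarith)
    linarith
  have hfin : k / 4 ≤ Real.log 2 * (k - 1) - x * (ε ^ 2 / ((p - ε) * (1 - (p - ε)))) := by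
    -- For k = 2 the ratio bound ρ = 2 is too weak; αx ≥ 56 gives ε ≤ p/12 and hence ρ = 12/11.
    rcases hk with rfl | hk
    · have hε12 : ε ≤ p / 12 := by
        apply abs_le_of_sq_le_sq' _ (by linarith) |>.2
        rw [hεsq, div_le_iff₀ (by positivity)]
        have : 18 ≤ p * x := by rw [hp]; linarith
        nlinarith
      have := hd (12 / 11) (by linarith) (by norm_num)
      linarith
    · have := hd 2 (by linarith) (by norm_num)
      have h2 := mul_le_mul_of_nonneg_right hlog.le (show 0 ≤ k - 1 by linarith)
      linarith
  refine ⟨p - ε, hq0, by linarith, ?_⟩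
  rw [← hS, ← hp, sub_sub_cancel]
  -- 0.176/4 = 0.044 exceeds 1/27, and S ≥ 10 lets the surplus absorb 1/32.
  calc k * (S / 27 + 1 / 32) < 0.176 * S * (k / 4) := by nlinarith
    _ ≤ ε * x * (k / 4) := by gcongr
    _ ≤ _ := by gcongr

end Bandit

/-! ### Conclusion -/

theorem theorem3 (K T : ℕ) (hK : 2 ≤ K) (hT : max K 118 ≤ T) (α : ℝ)
    (hα : α ∈ Set.Icc (max (64 / 9 * Real.log (32 * (T : ℝ))) ((K : ℝ) / 2) / (T : ℝ)) (1 / 2))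
    (A : Bandit.RandomisedAlgorithm K) :
    Real.sqrt (α * (T : ℝ) * (K : ℝ)) / 27 ≤
      sSup ((fun ℓ : Bandit.LossSeq K T => A.expectedRegret ℓ) '' Bandit.smallLossBall K T α) := by
  have hT118 : (118 : ℝ) ≤ T := by exact_mod_cast (le_max_right _ _).trans hT
  have hT0 : (0 : ℝ) < T := by linarith
  have hTpos : 0 < T := by exact_mod_cast hT0
  have hmax := (div_le_iff₀ hT0).1 hα.1
  have hα1 := (le_max_left _ _).trans hmax
  have hα2 := (le_max_right _ _).trans hmax
  have hlog := Bandit.eight_le_log hT118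
  have hk : (K : ℝ) = 2 ∨ (3 : ℝ) ≤ K := by
    rcases hK.eq_or_lt with h | h
    · left; exact_mod_cast h.symm
    · right; exact_mod_cast h
  obtain ⟨q, hq0, hqp, hgap⟩ := Bandit.exists_gap hk hT0 (by linarith) hα2 hα.2
  by_contra! hlt
  have hp1 : α / 2 < 1 := by linarith [hα.2]
  -- Boundedness matters: the real `sSup` of an unbounded set is 0 by convention.
  have hbdd : BddAbove ((fun ℓ : Bandit.LossSeq K T => A.expectedRegret ℓ) ''
      Bandit.smallLossBall K T α) := by
    refine ⟨T, ?_⟩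
    rintro _ ⟨ℓ, -, rfl⟩
    exact A.expectedRegret_le ℓ
  have hup := Finset.sum_le_sum fun i (_ : i ∈ (Finset.univ : Finset (Fin K))) =>
    Bandit.sum_tableProb_mul_expectedRegret_le A (α := α)
      (B := Real.sqrt (α * (T : ℝ) * (K : ℝ)) / 27) hTpos hq0.le hqp hp1.le (by positivity)
      (fun ℓ hℓ => (le_csSup hbdd ⟨ℓ, hℓ, rfl⟩).trans hlt.le) i
  have hlow := Bandit.le_sum_sum_tableProb_mul_expectedRegret (T := T) A hq0 hqp hp1 hTpos
  have htail := Bandit.tail_le hT118 hqp hα1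
  rw [Finset.sum_const, Finset.card_univ, Fintype.card_fin, nsmul_eq_mul] at hup
  have hKpos : (0 : ℝ) ≤ K := by positivity
  have := mul_le_mul_of_nonneg_left
    (add_le_add_right htail (Real.sqrt (α * (T : ℝ) * (K : ℝ)) / 27)) hKpos
  linarith
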